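/- Let $k\ge 1$ and $S=\{z\in[-1,1]^k:\|z\|\le 1\}$, with $\|\cdot\|$ the Euclidean norm. Let $V=V_A\,\dot\cup\,V_B$ be a finite set of voters, where $V_A$ and $V_B$ are the supporters of the parties $A$ and $B$, and let each voter $v\in V$ have a preference vector $q_v\in S$. Put $Q_A=\sum_{v\in V_A}q_v$, $Q_B=\sum_{v\in V_B}q_v$ and $Q=\sum_{v\in V}q_v=Q_A+Q_B$, and assume the normalization $\|Q_A\|\le 1$, $\|Q_B\|\le 1$. In the two-party policy competition game, the parties $A$ and $B$ choose policies $z_A,z_B\in S$; party $A$ wins with probability $p_A=\tfrac12+\tfrac18(z_A-z_B)^{\top}Q$ and party $B$ with probability $p_B=1-p_A$; and party $X\in\{A,B\}$ receives the payoff $R_X(z_A,z_B)=p_A\,z_A^{\top}Q_X+p_B\,z_B^{\top}Q_X$. If the game is consensus-reachable, that is, $Q_A^{\top}Q\ge 0$ and $Q_B^{\top}Q\ge 0$, then it has a pure-strategy Nash equilibrium: there are $z_A,z_B\in S$ such that $R_A(z,z_B)\le R_A(z_A,z_B)$ and $R_B(z_A,z)\le R_B(z_A,z_B)$ for all $z\in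 S$. Moreover, $(z_A,z_B)$ can be chosen to be egoistic, that is, with $z_A^{\top}Q_A\ge z_B^{\top}Q_A$ and $z_B^{\top}Q_B\ge z_A^{\top}Q_B$. -/

import Mathlib

noncomputable section

/-- The policy domain `S = {z ∈ [-1, 1]^k : ‖z‖ ≤ 1}`, with the Euclidean norm. -/
def policyDomain (k : ℕ) : Set (EuclideanSpace ℝ (Fin k)) :=
  {z | (∀ i, z i ∈ Set.Icc (-1 : ℝ) 1) ∧ ‖z‖ ≤ 1}

/-- A two-party policy competition game in `ℝ^k` over a finite set `V` of voters: every voter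
supports exactly one of the parties `A`, `B` and has a preference vector in the policy domain, and
the sum of the preference vectors of the supporters of each party has norm at most `1`. -/
structure PolicyGame (k : ℕ) (V : Type*) [Fintype V] where
  /-- supporters of party `A` -/
  suppA : Finset V
  /-- supporters of party `B` -/
  suppB : Finset V
  disjoint_supp : Disjoint suppA suppB
  cover : ∀ v, v ∈ suppA ∨ v ∈ suppB
  /-- preference vectors of the voters -/
  pref : V → EuclideanSpace ℝ (Fin k)
  pref_mem : ∀ v, pref v ∈ policyDomain k
  norm_sum_suppA_le : ‖∑ v ∈ suppA, pref v‖ ≤ 1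
  norm_sum_suppB_le : ‖∑ v ∈ suppB, pref v‖ ≤ 1

namespace PolicyGame

variable {k : ℕ} {V : Type*} [Fintype V] (G : PolicyGame k V)

/-- `Q_A`: the aggregated preference vector of the supporters of `A`. -/
def QA : EuclideanSpace ℝ (Fin k) := ∑ v ∈ G.suppA, G.pref v

/-- `Q_B`: the aggregated preference vector of the supporters of `B`. -/
def QB : EuclideanSpace ℝ (Fin k) := ∑ v ∈ G.suppB, G.pref v

/-- `Q`: the aggregated preference vector of all voters. -/
def Q : EuclideanSpace ℝ (Fin k) := ∑ v, G.pref v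

/-- The winning probability of party `A` at the profile `(zA, zB)`. -/
def pA (zA zB : EuclideanSpace ℝ (Fin k)) : ℝ := 1 / 2 + 1 / 8 * inner ℝ (zA - zB) G.Q

/-- The winning probability of party `B` at the profile `(zA, zB)`. -/
def pB (zA zB : EuclideanSpace ℝ (Fin k)) : ℝ := 1 - G.pA zA zB

/-- The payoff of party `A`: the expected utility of its supporters under the winning policy. -/
def RA (zA zB : EuclideanSpace ℝ (Fin k)) : ℝ :=
  G.pA zA zB * inner ℝ zA G.QA + G.pB zA zB * inner ℝ zB G.QA

/-- The payoff of party `B`: the expected utility of its supporters under the winning policy. -/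
def RB (zA zB : EuclideanSpace ℝ (Fin k)) : ℝ :=
  G.pA zA zB * inner ℝ zA G.QB + G.pB zA zB * inner ℝ zB G.QB

/-- `Q_Aᵀ Q ≥ 0` and `Q_Bᵀ Q ≥ 0`. -/
def ConsensusReachable : Prop := 0 ≤ inner ℝ G.QA G.Q ∧ 0 ≤ inner ℝ G.QB G.Q

/-- Each party's policy gives its own supporters at least the utility that the opponent's does. -/
def Egoistic (zA zB : EuclideanSpace ℝ (Fin k)) : Prop :=
  inner ℝ zB G.QA ≤ inner ℝ zA G.QA ∧ inner ℝ zA G.QB ≤ inner ℝ zB G.QB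

/-- `(zA, zB)` is a pure-strategy Nash equilibrium: both policies lie in the policy domain, and no
party increases its payoff by a unilateral deviation to any other policy in the domain. -/
def IsPSNE (zA zB : EuclideanSpace ℝ (Fin k)) : Prop :=
  zA ∈ policyDomain k ∧ zB ∈ policyDomain k ∧
    (∀ z ∈ policyDomain k, G.RA z zB ≤ G.RA zA zB) ∧
    (∀ z ∈ policyDomain k, G.RB zA z ≤ G.RB zA zB)

end PolicyGame

end

/-!
Write `a`, `b` for the aggregated vectors of the two parties and `q = a + b`. Against an opponent's
policy `w`, a party with aggregated vector `a` maximizes `(4 + ⟪z - w, q⟫) * ⟪z - w, a⟫` over the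
unit ball (the box constraint in the policy domain is implied by the norm constraint). The gradient
of this objective is a combination of `a` and `q`, so a maximizer has the form
`heading a q s = (a + s q) / ‖a + s q‖`, where `s ≥ 0` solves the first-order condition
`s * (4 + ⟪z - w, q⟫) = ⟪z - w, a⟫`. Conversely, every solution `s ≥ 0` gives a maximizer: since
`z` maximizes `⟪·, a + s q⟫`, the sum of the factors `s * (4 + ⟪z - w, q⟫)` and `⟪z - w, a⟫` is
maximal at `z`, and they are equal there, so their product is maximal as well
(`payoff_le_of_firstOrderGap_eq_zero`). The condition also shows `⟪z - w, a⟫ ≥ 0`, which is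
egoism.

It remains to solve the first-order conditions of both parties simultaneously, and this needs no
topological fixed point theorem. The parameters live in `[0, 1]`; as `s` grows, `heading a q s`
turns from `a` towards `q`, so `⟪heading a q s, q⟫` increases and `⟪heading a q s, a⟫` decreases.
Hence the difference of the two sides of the condition, `firstOrderGap`, is strictly increasing in
the party's own parameter, and, because `s ≤ 1`, increasing in the opponent's one. So the solution
`s` is a decreasing function of the opponent's parameter `t`; the same holds with the parties
exchanged, the composition of the two reactions is increasing on `[0, 1]`, and the Knaster–Tarski
theorem gives a fixed point. If `a = 0` or `b = 0`, the profile in which both parties play the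
normalized `q` is an equilibrium.
-/

open scoped RealInnerProductSpace

/-! ### Unit vectors turning from one vector towards another -/

section Heading

variable {E : Type*} [NormedAddCommGroup E] [InnerProductSpace ℝ E]

/-- The vector `a + s q` scaled to norm `1`; it is `0` if `a + s q = 0`. -/
noncomputable def heading (a q : E) (s : ℝ) : E := ‖a + s • q‖⁻¹ • (a + s • q)

theorem norm_heading_le (a q : E) (s : ℝ) : ‖heading a q s‖ ≤ 1 := by
  rw [heading, norm_smul, norm_inv, norm_norm]
  exact inv_mul_le_one

theorem inner_le_inner_heading (a q : E) (s : ℝ) {x : E} (hx : ‖x‖ ≤ 1) :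
    ⟪x, a⟫ + s * ⟪x, q⟫ ≤ ⟪heading a q s, a⟫ + s * ⟪heading a q s, q⟫ := by
  have key : ∀ y : E, ⟪y, a⟫ + s * ⟪y, q⟫ = ⟪y, a + s • q⟫ := fun y => by
    rw [inner_add_right, inner_smul_right]
  rw [key, key]
  have h1 : ⟪x, a + s • q⟫ ≤ ‖a + s • q‖ :=
    (real_inner_le_norm _ _).trans (mul_le_of_le_one_left (norm_nonneg _) hx)
  have h2 : ⟪heading a q s, a + s • q⟫ = ‖a + s • q‖ := by
    rw [heading, real_inner_smul_left, real_inner_self_eq_norm_sq, pow_two]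
    by_cases h : ‖a + s • q‖ = 0
    · simp [h]
    · field_simp
  rw [h2]
  exact h1

theorem inner_heading_right_mono (a q : E) {s s' : ℝ} (hs : s ≤ s') :
    ⟪heading a q s, q⟫ ≤ ⟪heading a q s', q⟫ := by
  rcases hs.eq_or_lt with rfl | h
  · rfl
  have h1 := inner_le_inner_heading a q s (norm_heading_le a q s')
  have h2 := inner_le_inner_heading a q s' (norm_heading_le a q s)
  nlinarith

theorem inner_heading_left_anti (a q : E) {s s' : ℝ} (h0 : 0 ≤ s) (hs : s ≤ s') :
    ⟪heading a q s', a⟫ ≤ ⟪heading a q s, a⟫ := by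
  have h1 := inner_le_inner_heading a q s (norm_heading_le a q s')
  have h2 := mul_le_mul_of_nonneg_left (inner_heading_right_mono a q hs) h0
  linarith

theorem inner_heading_nonneg {a q : E} (haq : 0 ≤ ⟪a, q⟫) {s : ℝ} (hs : 0 ≤ s) :
    0 ≤ ⟪heading a q s, q⟫ := by
  rw [heading, real_inner_smul_left, inner_add_left, real_inner_smul_left]
  have := real_inner_self_nonneg (x := q)
  positivity

theorem continuousOn_heading {a q : E} (ha : a ≠ 0) (haq : 0 ≤ ⟪a, q⟫) :
    ContinuousOn (heading a q) (Set.Icc 0 1) := by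
  have hc : ContinuousOn (fun s : ℝ => a + s • q) (Set.Icc 0 1) := by fun_prop
  refine (hc.norm.inv₀ fun s hs h => ?_).smul hc
  have h0 : a + s • q = 0 := norm_eq_zero.1 h
  have h1 : ⟪a, a + s • q⟫ = 0 := by rw [h0, inner_zero_right]
  rw [inner_add_right, inner_smul_right] at h1
  have h2 : 0 < ⟪a, a⟫ := real_inner_self_pos.2 ha
  have h3 := mul_nonneg hs.1 haq
  linarith

theorem abs_inner_sub_le_two {x y v : E} (hx : ‖x‖ ≤ 1) (hy : ‖y‖ ≤ 1) (hv : ‖v‖ ≤ 1) :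
    |⟪x - y, v⟫| ≤ 2 := by
  have h1 := abs_real_inner_le_norm (x - y) v
  have h2 := norm_sub_le x y
  have h3 := norm_nonneg (x - y)
  nlinarith [norm_nonneg v]

theorem inner_le_two {y q : E} (hy : ‖y‖ ≤ 1) (hq : ‖q‖ ≤ 2) : ⟪y, q⟫ ≤ 2 := by
  have h1 := real_inner_le_norm y q
  nlinarith [norm_nonneg q, norm_nonneg y]

theorem four_add_inner_sub_nonneg {x w q : E} (hx : ‖x‖ ≤ 1) (hw : ‖w‖ ≤ 1) (hq : ‖q‖ ≤ 2) :
    0 ≤ 4 + ⟪x - w, q⟫ := by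
  have h1 := inner_le_two hw hq
  have h2 := inner_le_two (y := -x) (by rwa [norm_neg]) hq
  rw [inner_neg_left] at h2
  rw [inner_sub_left]
  linarith

end Heading

/-! ### The first-order condition for a best response -/

section FirstOrder

variable {E : Type*} [NormedAddCommGroup E] [InnerProductSpace ℝ E]

/-- The defect in the first-order condition of the party with vector `a` when it plays
`heading a q s` against `w`. -/
noncomputable def firstOrderGap (a q w : E) (s : ℝ) : ℝ :=
  s * (4 + ⟪heading a q s - w, q⟫) - ⟪heading a q s - w, a⟫

theorem two_le_four_add_inner_heading_sub {a q w : E} (haq : 0 ≤ ⟪a, q⟫) (hq : ‖q‖ ≤ 2)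
    (hw : ‖w‖ ≤ 1) {s : ℝ} (hs : 0 ≤ s) : 2 ≤ 4 + ⟪heading a q s - w, q⟫ := by
  have h1 := inner_heading_nonneg haq hs
  have h2 := inner_le_two hw hq
  rw [inner_sub_left]
  linarith

theorem firstOrderGap_lt {a q w : E} (haq : 0 ≤ ⟪a, q⟫) (hq : ‖q‖ ≤ 2) (hw : ‖w‖ ≤ 1)
    {s s' : ℝ} (h0 : 0 ≤ s) (hs : s < s') : firstOrderGap a q w s < firstOrderGap a q w s' := by
  have h1 := inner_heading_right_mono a q hs.le
  have h2 := inner_heading_left_anti a q h0 hs.le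
  have h3 := two_le_four_add_inner_heading_sub haq hq hw h0
  simp only [firstOrderGap, inner_sub_left] at *
  nlinarith

/-- The gap of one party increases with the parameter of the other party. -/
theorem firstOrderGap_mono_opponent {a b q : E} (hqab : q = a + b) {s t t' : ℝ} (hs : s ≤ 1)
    (h0 : 0 ≤ t) (ht : t ≤ t') :
    firstOrderGap a q (heading b q t) s ≤ firstOrderGap a q (heading b q t') s := by
  have h1 := inner_heading_right_mono b q ht
  have h2 := inner_heading_left_anti b q h0 ht
  -- The opponent's `y` enters the gap as `(1 - s) * ⟪y, q⟫ - ⟪y, b⟫`.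
  have h3 : ∀ y : E, ⟪y, a⟫ = ⟪y, q⟫ - ⟪y, b⟫ := fun y => by
    rw [hqab, inner_add_right]; ring
  simp only [firstOrderGap, inner_sub_left, h3 (heading b q t), h3 (heading b q t')]
  nlinarith

theorem exists_firstOrderGap_eq_zero {a b q w : E} (hqab : q = a + b) (ha : a ≠ 0)
    (haq : 0 ≤ ⟪a, q⟫) (hb : ‖b‖ ≤ 1) (hw : ‖w‖ ≤ 1) :
    ∃ s ∈ Set.Icc (0 : ℝ) 1, firstOrderGap a q w s = 0 := by
  have hc : ContinuousOn (firstOrderGap a q w) (Set.Icc 0 1) := by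
    have := continuousOn_heading ha haq
    unfold firstOrderGap
    fun_prop
  refine intermediate_value_Icc zero_le_one hc ⟨?_, ?_⟩
  · have h := inner_le_inner_heading a q 0 hw
    rw [firstOrderGap, inner_sub_left _ _ a]
    linarith
  · have h := (abs_le.1 (abs_inner_sub_le_two (norm_heading_le a q 1) hw hb)).1
    have h1 : ⟪heading a q 1 - w, q⟫ = ⟪heading a q 1 - w, a⟫ + ⟪heading a q 1 - w, b⟫ := by
      rw [← inner_add_right, ← hqab]
    rw [firstOrderGap, h1]
    linarith

theorem inner_heading_sub_nonneg {a q w : E} (haq : 0 ≤ ⟪a, q⟫) (hq : ‖q‖ ≤ 2) (hw : ‖w‖ ≤ 1)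
    {s : ℝ} (hs : 0 ≤ s) (h : firstOrderGap a q w s = 0) : 0 ≤ ⟪heading a q s - w, a⟫ := by
  have h1 := two_le_four_add_inner_heading_sub haq hq hw hs
  rw [firstOrderGap, sub_eq_zero] at h
  rw [← h]
  exact mul_nonneg hs (by linarith)

/-- The first-order condition is sufficient for a best response. -/
theorem payoff_le_of_firstOrderGap_eq_zero {a q w x : E} (haq : 0 ≤ ⟪a, q⟫) (hq : ‖q‖ ≤ 2)
    (hw : ‖w‖ ≤ 1) (hx : ‖x‖ ≤ 1) {s : ℝ} (hs : 0 ≤ s) (h : firstOrderGap a q w s = 0) :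
    (4 + ⟪x - w, q⟫) * ⟪x - w, a⟫ ≤
      (4 + ⟪heading a q s - w, q⟫) * ⟪heading a q s - w, a⟫ := by
  have hD := two_le_four_add_inner_heading_sub haq hq hw hs
  have hG := inner_heading_sub_nonneg haq hq hw hs h
  have hD' := four_add_inner_sub_nonneg hx hw hq
  have hmax : s * (4 + ⟪x - w, q⟫) + ⟪x - w, a⟫ ≤
      s * (4 + ⟪heading a q s - w, q⟫) + ⟪heading a q s - w, a⟫ := by
    have := inner_le_inner_heading a q s hx
    simp only [inner_sub_left]
    linarith
  rw [firstOrderGap, sub_eq_zero] at h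
  generalize 4 + ⟪x - w, q⟫ = D' at *
  generalize ⟪x - w, a⟫ = G' at *
  generalize 4 + ⟪heading a q s - w, q⟫ = D at *
  generalize ⟪heading a q s - w, a⟫ = G at *
  subst h
  rcases le_or_gt G' 0 with hG' | hG'
  · exact (mul_nonpos_of_nonneg_of_nonpos hD' hG').trans (mul_nonneg (by linarith) hG)
  rcases hs.eq_or_lt with rfl | hs'
  · linarith
  -- AM-GM: `4 * (s * D') * G' ≤ (s * D' + G') ^ 2 ≤ (2 * s * D) ^ 2`.
  have h1 : (s * D' + G') ^ 2 ≤ (s * D + s * D) ^ 2 :=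
    pow_le_pow_left₀ (by positivity) hmax 2
  have h2 : s * (D' * G') ≤ s * (D * (s * D)) := by nlinarith [sq_nonneg (s * D' - G')]
  exact le_of_mul_le_mul_left h2 hs'

end FirstOrder

/-! ### Existence of an egoistic equilibrium -/

section Equilibrium

variable {E : Type*} [NormedAddCommGroup E] [InnerProductSpace ℝ E]

/-- Two decreasing reaction functions on `[0, 1]` have a mutual fixed point, by the Knaster–Tarski
theorem for their composition. -/
theorem exists_mutual_fixedPoint {f g : Set.Icc (0 : ℝ) 1 → Set.Icc (0 : ℝ) 1} (hf : Antitone f)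
    (hg : Antitone g) : ∃ s t, f t = s ∧ g s = t := by
  let F : Set.Icc (0 : ℝ) 1 →o Set.Icc (0 : ℝ) 1 := ⟨f ∘ g, hf.comp hg⟩
  exact ⟨F.lfp, g F.lfp, F.map_lfp, rfl⟩

theorem exists_antitone_reaction {a b q : E} (hqab : q = a + b) (ha : a ≠ 0)
    (haq : 0 ≤ ⟪a, q⟫) (hq : ‖q‖ ≤ 2) (hb : ‖b‖ ≤ 1) :
    ∃ f : Set.Icc (0 : ℝ) 1 → Set.Icc (0 : ℝ) 1, Antitone f ∧
      ∀ t : Set.Icc (0 : ℝ) 1, firstOrderGap a q (heading b q t) (f t) = 0 := by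
  choose f hf0 hf using fun t : Set.Icc (0 : ℝ) 1 =>
    exists_firstOrderGap_eq_zero hqab ha haq hb (norm_heading_le b q t)
  refine ⟨fun t => ⟨f t, hf0 t⟩, fun t t' htt' => ?_, hf⟩
  by_contra! hlt
  have h1 := firstOrderGap_lt haq hq (norm_heading_le b q t') (hf0 t).1 hlt
  have h2 := firstOrderGap_mono_opponent hqab (hf0 t).2 t.2.1 htt'
  rw [hf] at h1 h2
  exact absurd h1 h2.not_gt

theorem exists_firstOrderGap_eq_zero_both {a b q : E} (hqab : q = a + b) (ha0 : a ≠ 0)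
    (hb0 : b ≠ 0) (haq : 0 ≤ ⟪a, q⟫) (hbq : 0 ≤ ⟪b, q⟫) (hq : ‖q‖ ≤ 2) (ha : ‖a‖ ≤ 1)
    (hb : ‖b‖ ≤ 1) :
    ∃ s t : ℝ, 0 ≤ s ∧ 0 ≤ t ∧ firstOrderGap a q (heading b q t) s = 0 ∧
      firstOrderGap b q (heading a q s) t = 0 := by
  obtain ⟨f, hf, hf0⟩ := exists_antitone_reaction hqab ha0 haq hq hb
  obtain ⟨g, hg, hg0⟩ := exists_antitone_reaction (hqab.trans (add_comm a b)) hb0 hbq hq ha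
  obtain ⟨s, t, rfl, hgs⟩ := exists_mutual_fixedPoint hf hg
  refine ⟨f t, t, (f t).2.1, t.2.1, hf0 t, ?_⟩
  have := hg0 (f t)
  rwa [hgs] at this

/-- The equilibrium in terms of the net payoffs `(4 + ⟪z - w, q⟫) * ⟪z - w, a⟫` over the unit
ball of an inner product space. -/
theorem exists_egoistic_equilibrium {a b q : E} (hqab : q = a + b) (haq : 0 ≤ ⟪a, q⟫)
    (hbq : 0 ≤ ⟪b, q⟫) (ha : ‖a‖ ≤ 1) (hb : ‖b‖ ≤ 1) :
    ∃ z w : E, ‖z‖ ≤ 1 ∧ ‖w‖ ≤ 1 ∧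
      (∀ x, ‖x‖ ≤ 1 →
        (4 + ⟪x - w, q⟫) * ⟪x - w, a⟫ ≤ (4 + ⟪z - w, q⟫) * ⟪z - w, a⟫) ∧
      (∀ x, ‖x‖ ≤ 1 →
        (4 + ⟪x - z, q⟫) * ⟪x - z, b⟫ ≤ (4 + ⟪w - z, q⟫) * ⟪w - z, b⟫) ∧
      0 ≤ ⟪z - w, a⟫ ∧ 0 ≤ ⟪w - z, b⟫ := by
  have hq : ‖q‖ ≤ 2 := by
    rw [hqab]
    exact (norm_add_le a b).trans (by linarith)
  by_cases hab : a ≠ 0 ∧ b ≠ 0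
  · obtain ⟨s, t, hs, ht, h1, h2⟩ :=
      exists_firstOrderGap_eq_zero_both hqab hab.1 hab.2 haq hbq hq ha hb
    have hz := norm_heading_le a q s
    have hw := norm_heading_le b q t
    exact ⟨heading a q s, heading b q t, hz, hw,
      fun x hx => payoff_le_of_firstOrderGap_eq_zero haq hq hw hx hs h1,
      fun x hx => payoff_le_of_firstOrderGap_eq_zero hbq hq hz hx ht h2,
      inner_heading_sub_nonneg haq hq hw hs h1, inner_heading_sub_nonneg hbq hq hz ht h2⟩
  -- One of `a`, `b` is `0`, the other is `q`, and both parties play the normalized `q`.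
  · have hz := norm_heading_le q q 0
    have hdev : ∀ x : E, ‖x‖ ≤ 1 → ∀ v, v = 0 ∨ v = q →
        (4 + ⟪x - heading q q 0, q⟫) * ⟪x - heading q q 0, v⟫ ≤ 0 := by
      rintro x hx v (rfl | rfl)
      · simp
      · refine mul_nonpos_of_nonneg_of_nonpos (four_add_inner_sub_nonneg hx hz hq) ?_
        have := inner_le_inner_heading v v 0 hx
        rw [inner_sub_left]
        linarith
    have hcase : (a = 0 ∨ a = q) ∧ (b = 0 ∨ b = q) := by
      by_cases h : a = 0
      · exact ⟨Or.inl h, Or.inr (by rw [hqab, h, zero_add])⟩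
      · have hb0 : b = 0 := by
          by_contra hb0
          exact hab ⟨h, hb0⟩
        exact ⟨Or.inr (by rw [hqab, hb0, add_zero]), Or.inl hb0⟩
    refine ⟨heading q q 0, heading q q 0, hz, hz, fun x hx => ?_, fun x hx => ?_, ?_, ?_⟩
    · simpa using hdev x hx a hcase.1
    · simpa using hdev x hx b hcase.2
    · simp
    · simp

end Equilibrium

/-! ### The policy competition game -/

theorem mem_policyDomain_iff {k : ℕ} {z : EuclideanSpace ℝ (Fin k)} :
    z ∈ policyDomain k ↔ ‖z‖ ≤ 1 := by
  refine ⟨fun h => h.2, fun h => ⟨fun i => ?_, h⟩⟩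
  exact abs_le.1 ((PiLp.norm_apply_le z i).trans h)

namespace PolicyGame

variable {k : ℕ} {V : Type*} [Fintype V] (G : PolicyGame k V)

theorem Q_eq_add : G.Q = G.QA + G.QB := by
  classical
  have h : (Finset.univ : Finset V) = G.suppA ∪ G.suppB := by
    ext v
    simpa using G.cover v
  rw [Q, h, Finset.sum_union G.disjoint_supp, QA, QB]

theorem RA_eq (z w : EuclideanSpace ℝ (Fin k)) :
    G.RA z w = inner ℝ w G.QA + 1 / 8 * ((4 + ⟪z - w, G.Q⟫) * ⟪z - w, G.QA⟫) := by
  rw [RA, pB, pA, inner_sub_left z w G.QA]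
  ring

theorem RB_eq (z w : EuclideanSpace ℝ (Fin k)) :
    G.RB z w = inner ℝ z G.QB + 1 / 8 * ((4 + ⟪w - z, G.Q⟫) * ⟪w - z, G.QB⟫) := by
  rw [RB, pB, pA]
  simp only [inner_sub_left]
  ring

end PolicyGame

theorem theorem2 {k : ℕ} {V : Type*} [Fintype V] (G : PolicyGame k V)
    (hG : G.ConsensusReachable) :
    ∃ zA zB : EuclideanSpace ℝ (Fin k), G.IsPSNE zA zB ∧ G.Egoistic zA zB := by
  obtain ⟨z, w, hz, hw, hA, hB, hEA, hEB⟩ := exists_egoistic_equilibrium G.Q_eq_add hG.1 hG.2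
    G.norm_sum_suppA_le G.norm_sum_suppB_le
  rw [inner_sub_left, sub_nonneg] at hEA hEB
  refine ⟨z, w, ⟨mem_policyDomain_iff.2 hz, mem_policyDomain_iff.2 hw, fun x hx => ?_,
    fun x hx => ?_⟩, hEA, hEB⟩
  · have := hA x (mem_policyDomain_iff.1 hx)
    rw [G.RA_eq, G.RA_eq]
    linarith
  · have := hB x (mem_policyDomain_iff.1 hx)
    rw [G.RB_eq, G.RB_eq]
    linarith
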